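/- Let $\mathbb{A}$ be a finite-dimensional commutative associative algebra with unit over $\mathbb{C}$, and let $f_1,\dots,f_m:\mathbb{A}\to\mathbb{C}$ be all its unital $\mathbb{C}$-algebra homomorphisms (equivalently, the linear functionals with $f_u(1)=1$ whose kernels are the maximal ideals of $\mathbb{A}$). Let $k\ge 2$, let $e_1=1,e_2,\dots,e_k\in\mathbb{A}$ be linearly independent over $\mathbb{R}$, and let $E_k=\{\sum_{j=1}^k x_je_j : x_j\in\mathbb{R}\}$. A function $\Phi$ from an open set $G\subset E_k$ to $\mathbb{A}$ is called monogenic in $G$ if it is continuous in $G$ and for every $\zeta\in G$ there is $\Phi'(\zeta)\in\mathbb{A}$ with $$\lim_{\varepsilon\to 0+}\frac{\Phi(\zeta+\varepsilon h)-\Phi(\zeta)}{\varepsilon}=h\,\Phi'(\zeta)\qquad\text{for all }h\in E_k .$$ Let $\Omega\subset E_k$ be a domain (non-empty, open, connected). Suppose that for all $u=1,\dots,m$ one has $f_u(E_k)=\mathbb{C}$, and $\Omega$ is convex with respect to the set of directions $M_u=\{\zeta\in E_k: f_u(\zeta)=0\}$, i.e. $\Omega$ contains the segment joining $\zeta_1$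 and $\zeta_2$ whenever $\zeta_1,\zeta_2\in\Omega$ and $\zeta_2-\zeta_1\in M_u$. Put $D_u=f_u(\Omega)$ and $$\Pi=\{\zeta\in E_k:\ f_u(\zeta)\in D_u,\ u=1,\dots,m\}.$$ Then $\Pi$ is an open set containing $\Omega$, and every function $\Phi:\Omega\to\mathbb{A}$ monogenic in $\Omega$ extends to a function $\Pi\to\mathbb{A}$ monogenic in $\Pi$. -/

import Mathlib

open Filter Topology

namespace MonogenicAlgebra

/-- The real linear span `E_k` of the vectors `e_1, …, e_k` of a complex algebra. -/
abbrev Ek {A : Type*} [CommRing A] [Algebra ℂ A] {k : ℕ} (e : Fin k → A) : Submodule ℝ A :=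
  Submodule.span ℝ (Set.range e)

/-- A function `Φ` with values in `A` is monogenic in a set `Ω ⊆ E` (used for open `Ω`): it is
continuous in `Ω` and at each `ζ ∈ Ω` it has a Gateaux derivative `Φ'(ζ) ∈ A`, i.e.
`(Φ (ζ + ε h) - Φ ζ) / ε → h Φ'(ζ)` as `ε → 0+`, for every `h ∈ E`.
Only the values of `Φ` on `Ω` matter when `Ω` is open. -/
def MonogenicOn {A : Type*} [CommRing A] [Algebra ℂ A] [TopologicalSpace A]
    {E : Submodule ℝ A} (Φ : E → A) (Ω : Set E) : Prop :=
  ContinuousOn Φ Ω ∧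
    ∀ ζ ∈ Ω, ∃ Φ' : A, ∀ h : E,
      Tendsto (fun ε : ℝ => ε⁻¹ • (Φ (ζ + ε • h) - Φ ζ)) (𝓝[>] (0 : ℝ)) (𝓝 ((h : A) * Φ'))

/-- The set of directions `M_u = {ζ ∈ E : f_u(ζ) = 0}`. -/
def directions {A : Type*} [CommRing A] [Algebra ℂ A] (E : Submodule ℝ A) (f : A →ₐ[ℂ] ℂ) :
    Set E :=
  {ζ | f (ζ : A) = 0}

/-- `Ω` is convex with respect to the set of directions `M`. -/
def ConvexWrt {A : Type*} [CommRing A] [Algebra ℂ A] {E : Submodule ℝ A} (Ω M : Set E) : Prop :=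
  ∀ ζ₁ ∈ Ω, ∀ ζ₂ ∈ Ω, ζ₂ - ζ₁ ∈ M →
    ∀ α ∈ Set.Icc (0 : ℝ) 1, ζ₁ + α • (ζ₂ - ζ₁) ∈ Ω

/-- The image `D_u = f_u(Ω)`. -/
def imageD {A : Type*} [CommRing A] [Algebra ℂ A] {E : Submodule ℝ A} (f : A →ₐ[ℂ] ℂ)
    (Ω : Set E) : Set ℂ :=
  (fun ζ : E => f (ζ : A)) '' Ω

/-- The set `Π = {ζ ∈ E : f_u(ζ) ∈ D_u for all u}`. -/
def bigPi {A : Type*} [CommRing A] [Algebra ℂ A] {E : Submodule ℝ A} (Ω : Set E) : Set E :=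
  {ζ | ∀ f : A →ₐ[ℂ] ℂ, f (ζ : A) ∈ imageD f Ω}

/-- A Cartan basis `I_1, …, I_m` (idempotents), `I_{m+1}, …, I_{m+l}` (nilpotents), `m + l = n`. -/
structure IsCartanBasis {A : Type*} [CommRing A] [Algebra ℂ A] {m l : ℕ}
    (I : Module.Basis (Fin m ⊕ Fin l) ℂ A) : Prop where
  idem : ∀ r s : Fin m, I (.inl r) * I (.inl s) = if r = s then I (.inl r) else 0
  nil : ∀ r s : Fin l,
    I (.inr r) * I (.inr s) ∈ Submodule.span ℂ ((fun p => I (.inr p)) '' {p | max r s < p})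
  mixed : ∀ s : Fin l, ∃! u : Fin m, ∀ r : Fin m,
    I (.inl r) * I (.inr s) = if r = u then I (.inr s) else 0

/-- For every Cartan basis, the functionals `f_u` (`f_u(I_u) = 1` and `f_u(I_r) = 0` for the other
basis vectors, `u = 1, …, m`) are exactly the unital algebra homomorphisms `A → ℂ`. So
"for all `f_u`" is "for all `f : A →ₐ[ℂ] ℂ`", whatever Cartan basis is used. -/
theorem IsCartanBasis.algHom_iff {A : Type*} [CommRing A] [Algebra ℂ A] {m l : ℕ}
    {I : Module.Basis (Fin m ⊕ Fin l) ℂ A} (hI : IsCartanBasis I) (g : A →ₗ[ℂ] ℂ) :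
    (∃ f : A →ₐ[ℂ] ℂ, f.toLinearMap = g) ↔ ∃ u : Fin m, g = I.coord (.inl u) := by
  constructor
  · rintro ⟨f, rfl⟩
    have hnil : ∀ s : Fin l, f (I (.inr s)) = 0 := by
      intro s
      induction s using WellFoundedGT.induction with
      | ind s ih =>
        have h1 : Submodule.span ℂ ((fun p => I (.inr p)) '' {p | max s s < p}) ≤
            LinearMap.ker f.toLinearMap := by
          rw [Submodule.span_le]
          rintro _ ⟨p, hp, rfl⟩
          exact ih p (by simpa using hp)
        have h2 := h1 (hI.nil s s)
        simpa using h2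
    have hex : ∃ u : Fin m, f (I (.inl u)) ≠ 0 := by
      by_contra! hcon
      have h0 : f.toLinearMap = 0 := by
        refine I.ext ?_
        rintro (r | s)
        · simpa using hcon r
        · simpa using hnil s
      have h1 : f 1 = 0 := by simpa using LinearMap.congr_fun h0 1
      simp at h1
    obtain ⟨u, hu⟩ := hex
    refine ⟨u, I.ext ?_⟩
    rintro (r | s)
    · have h := congrArg f (hI.idem r u)
      rw [map_mul] at h
      by_cases hru : r = u
      · subst hru
        simp only [if_true] at h
        have : f (I (.inl r)) = 1 := mul_right_cancel₀ hu (by rw [h, one_mul])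
        simpa using this
      · simp only [hru, if_false, map_zero, mul_eq_zero, hu, or_false] at h
        simp [h, hru]
    · simp [hnil s]
  · rintro ⟨u, rfl⟩
    have hmul : ∀ a b : A, I.coord (.inl u) (a * b) = I.coord (.inl u) a * I.coord (.inl u) b := by
      have hspan : ∀ r s : Fin l, I.coord (.inl u) (I (.inr r) * I (.inr s)) = 0 := by
        intro r s
        have h1 : Submodule.span ℂ ((fun p => I (.inr p)) '' {p | max r s < p}) ≤
            LinearMap.ker (I.coord (.inl u)) := by
          rw [Submodule.span_le]
          rintro _ ⟨p, _, rfl⟩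
          simp
        exact h1 (hI.nil r s)
      have hmix : ∀ (r : Fin m) (s : Fin l),
          I.coord (.inl u) (I (.inl r) * I (.inr s)) = 0 := by
        intro r s
        obtain ⟨v, hv, _⟩ := hI.mixed s
        rw [hv r]
        split_ifs <;> simp
      have key : (LinearMap.mul ℂ A).compr₂ (I.coord (.inl u)) =
          (LinearMap.mul ℂ ℂ).compl₁₂ (I.coord (.inl u)) (I.coord (.inl u)) := by
        refine I.ext fun i => I.ext fun j => ?_
        simp only [LinearMap.compr₂_apply, LinearMap.mul_apply', LinearMap.compl₁₂_apply]
        rcases i with r | r <;> rcases j with s | s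
        · rw [hI.idem]
          by_cases hrs : r = s
          · subst hrs
            by_cases hru : r = u <;> simp [hru]
          · by_cases hru : r = u
            · subst hru
              simp [Finsupp.single_apply, hrs]
            · simp [hrs, hru]
        · rw [hmix]; simp
        · rw [mul_comm (I _), hmix]; simp
        · rw [hspan]; simp
      intro a b
      simpa using LinearMap.congr_fun (LinearMap.congr_fun key a) b
    have hone : I.coord (.inl u) 1 = 1 := by
      have h := hmul 1 (I (.inl u))
      simpa using h.symm
    exact ⟨AlgHom.ofLinearMap (I.coord (.inl u)) hone hmul, by ext; simp⟩

end MonogenicAlgebra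

/-! The proof peels off one simple composition factor of an ideal at a time. If `Φ` takes values in
an ideal `J ≠ 0`, then `J` has a simple quotient, on which `A` acts through a character `f`. This
gives a functional `l` with `l (a x) = f a * l x` on `J`. The Gateaux derivative of `l ∘ Φ` in a
direction `h` is then `f h` times a number, so it vanishes along the kernel of `f`. Convexity in
those directions yields `l ∘ Φ = F ∘ f` on `Ω`.

The function `F` on `f(Ω)` is continuous and satisfies the Cauchy–Riemann equation pointwise. Real
differentiability is not available, so holomorphy comes from the Looman–Menchoff theorem.

A Taylor sum in the element `ζ - f ζ`, multiplied by an element of `J` that makes its tail vanish,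
lifts `F` to a monogenic function on all of `{f ζ ∈ f(Ω)}`, which contains `Π`. Subtracting the lift
moves the values of `Φ` into the smaller ideal `J ∩ ker l`. Since `A` is Artinian, the process ends
at the zero ideal, and `Φ` is a sum of functions that all extend to `Π`. -/

namespace MonogenicAlgebra

/-! ### The Looman–Menchoff theorem. -/

section LoomanMenchoff

open MeasureTheory Metric

/-- A continuous function on a disc which is Lipschitz at every point of
the disc with a fixed constant is Lipschitz on the disc. -/
theorem lipschitzOnWith_ball_of_eventually {F : ℂ → ℂ} {c : ℂ} {R : ℝ} {C : NNReal}
    (hF : ContinuousOn F (ball c R))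
    (h : ∀ p ∈ ball c R, ∀ᶠ q in 𝓝 p, ‖F q - F p‖ ≤ C * ‖q - p‖) :
    LipschitzOnWith C F (ball c R) := by
  refine LipschitzOnWith.of_dist_le_mul fun x hx y hy => ?_
  rw [dist_comm x y, dist_comm (F x)]
  set γ : ℝ → ℂ := fun t => x + (t : ℂ) * (y - x) with hγ
  have hγc : Continuous γ := by fun_prop
  have hmem : ∀ t ∈ Set.Icc (0 : ℝ) 1, γ t ∈ ball c R := by
    intro t ht
    have := (convex_ball c R).add_smul_sub_mem hx hy ht
    simpa [hγ] using this
  -- Along the segment from `x` to `y`, the growth of `‖F - F x‖` is compared with a linear function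
  -- of slope `C * ‖y - x‖`.
  have key := image_le_of_liminf_slope_right_le_deriv_boundary
    (f := fun t => ‖F (γ t) - F x‖) (a := 0) (b := 1)
    ((hF.comp hγc.continuousOn hmem).sub continuousOn_const).norm
    (B := fun t => C * ‖y - x‖ * t) (B' := fun _ => (C : ℝ) * ‖y - x‖) (by simp [hγ])
    (by fun_prop) ?_ ?_ (x := 1) (by simp)
  · simpa [hγ, dist_eq_norm] using key
  · intro t _
    simpa using ((hasDerivAt_id t).const_mul ((C : ℝ) * ‖y - x‖)).hasDerivWithinAt
  · intro t ht r hr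
    refine Eventually.frequently ?_
    have h1 := hγc.continuousAt.eventually (h (γ t) (hmem t ⟨ht.1, ht.2.le⟩))
    filter_upwards [h1.filter_mono nhdsWithin_le_nhds, self_mem_nhdsWithin] with s hs hst
    refine lt_of_le_of_lt ?_ hr
    have hst' : 0 < s - t := sub_pos.2 hst
    rw [slope_def_field, div_le_iff₀ hst']
    have e1 : γ s - γ t = ((s - t : ℝ) : ℂ) * (y - x) := by
      simp only [hγ]; push_cast; ring
    rw [e1, norm_mul, Complex.norm_real, Real.norm_of_nonneg hst'.le] at hs
    have := norm_sub_norm_le (F (γ s) - F x) (F (γ t) - F x)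
    rw [sub_sub_sub_cancel_right] at this
    linarith

/-- The real partial derivatives exist at `z` and satisfy the Cauchy–Riemann equation. -/
def HasCauchyRiemannAt (F : ℂ → ℂ) (z : ℂ) : Prop :=
  ∃ g : ℂ, HasDerivAt (fun t : ℝ => F (z + t)) g 0 ∧
    HasDerivAt (fun t : ℝ => F (z + t * Complex.I)) (Complex.I * g) 0

theorem HasCauchyRiemannAt.differentiableAt {F : ℂ → ℂ} {z : ℂ} (h : HasCauchyRiemannAt F z)
    (hd : DifferentiableAt ℝ F z) : DifferentiableAt ℂ F z := by
  obtain ⟨g, h1, h2⟩ := h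
  rw [differentiableAt_complex_iff_differentiableAt_real]
  refine ⟨hd, ?_⟩
  have key : ∀ w : ℂ, HasDerivAt (fun t : ℝ => F (z + t * w)) (fderiv ℝ F z w) 0 := by
    intro w
    have hl : HasDerivAt (fun t : ℝ => z + (t : ℂ) * w) w 0 := by
      simpa using ((hasDerivAt_id (0 : ℝ)).ofReal_comp.mul_const w).const_add z
    have hd' : HasFDerivAt F (fderiv ℝ F z) (z + ((0 : ℝ) : ℂ) * w) := by
      simpa using hd.hasFDerivAt
    exact hd'.comp_hasDerivAt (0 : ℝ) hl
  have e1 := (key 1).unique (by simpa using h1)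
  have e2 := (key Complex.I).unique h2
  rw [e1, e2, smul_eq_mul]

/-- By Rademacher, `F` is real differentiable almost everywhere, hence complex differentiable there.
Its averages over discs of radius `δ` can be differentiated under the integral, with the Lipschitz
constant as dominating function, so they are holomorphic. They converge uniformly to `F`, with error
at most `C * δ`. The doubled radius leaves room for the translates. -/
theorem differentiableOn_of_lipschitzOnWith_of_cauchyRiemann {F : ℂ → ℂ} (hFc : Continuous F)
    {c : ℂ} {R : ℝ} {C : NNReal} (hL : LipschitzOnWith C F (ball c (2 * R)))
    (hCR : ∀ z ∈ ball c (2 * R), HasCauchyRiemannAt F z) :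
    DifferentiableOn ℂ F (ball c R) := by
  rcases le_or_gt R 0 with hR | hR
  · rw [ball_eq_empty.2 hR]; exact differentiableOn_empty
  have hae : ∀ᵐ z : ℂ, z ∈ ball c (2 * R) → DifferentiableAt ℂ F z := by
    have h1 := (ae_restrict_iff' measurableSet_ball).1
      (hL.ae_differentiableWithinAt (μ := volume) measurableSet_ball)
    filter_upwards [h1] with z hz hzb
    exact (hCR z hzb).differentiableAt ((hz hzb).differentiableAt (isOpen_ball.mem_nhds hzb))
  let μ : ℝ → Measure ℂ := fun δ => ProbabilityTheory.cond volume (ball 0 δ)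
  have hac : ∀ δ, μ δ ≪ volume := fun δ => ProbabilityTheory.cond_absolutelyContinuous
  have hprob : ∀ δ, 0 < δ → IsProbabilityMeasure (μ δ) := fun δ hδ =>
    ProbabilityTheory.cond_isProbabilityMeasure_of_finite (measure_ball_pos volume 0 hδ).ne'
      measure_ball_lt_top.ne
  have hmem : ∀ δ, ∀ᵐ t ∂(μ δ), t ∈ ball (0 : ℂ) δ := fun δ =>
    ProbabilityTheory.ae_cond_mem measurableSet_ball
  have hadd : ∀ {δ : ℝ} {z t : ℂ}, δ ≤ R → z ∈ ball c R → t ∈ ball (0 : ℂ) δ →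
      z + t ∈ ball c (2 * R) := by
    intro δ z t hδ hz ht
    rw [mem_ball, dist_eq_norm] at hz ⊢
    rw [mem_ball_zero_iff] at ht
    have : z + t - c = (z - c) + t := by ring
    rw [this]
    have := norm_add_le (z - c) t
    linarith
  have hint : ∀ δ, 0 < δ → ∀ z, Integrable (fun t => F (z + t)) (μ δ) := by
    intro δ hδ z
    have := hprob δ hδ
    obtain ⟨M, hM⟩ := ((isCompact_closedBall (0 : ℂ) δ).image
      (f := fun t => F (z + t)) (by fun_prop)).isBounded.exists_norm_le
    refine Integrable.of_bound (by fun_prop) M ?_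
    filter_upwards [hmem δ] with t ht
    exact hM _ ⟨t, ball_subset_closedBall ht, rfl⟩
  have hunif : TendstoUniformlyOn (fun δ z => ∫ t, F (z + t) ∂(μ δ)) F (𝓝[>] (0 : ℝ))
      (ball c R) := by
    rw [Metric.tendstoUniformlyOn_iff]
    intro ε hε
    have hlim : Tendsto (fun δ : ℝ => (C : ℝ) * δ) (𝓝[>] 0) (𝓝 0) := by
      have : Tendsto (fun δ : ℝ => (C : ℝ) * δ) (𝓝 0) (𝓝 ((C : ℝ) * 0)) :=
        Continuous.tendsto (by fun_prop) 0
      rw [mul_zero] at this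
      exact this.mono_left nhdsWithin_le_nhds
    filter_upwards [hlim.eventually_lt_const hε, self_mem_nhdsWithin,
      nhdsWithin_le_nhds (Iio_mem_nhds hR)] with δ h1 hδ hδR z hz
    have hδ0 : 0 < δ := hδ
    have := hprob δ hδ0
    rw [dist_comm, dist_eq_norm]
    refine lt_of_le_of_lt ?_ h1
    have e : ∫ t, F (z + t) ∂(μ δ) - F z = ∫ t, (F (z + t) - F z) ∂(μ δ) := by
      rw [integral_sub (hint δ hδ z) (integrable_const _)]; simp
    rw [e]
    have := norm_integral_le_of_norm_le_const (μ := μ δ) (C := (C : ℝ) * δ)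
      (f := fun t => F (z + t) - F z) ?_
    · simpa using this
    filter_upwards [hmem δ] with t ht
    have h2 := hL.dist_le_mul _ (hadd (le_of_lt hδR) hz ht) z
      (ball_subset_ball (by linarith) hz)
    rw [dist_eq_norm, dist_eq_norm, add_sub_cancel_left] at h2
    rw [mem_ball_zero_iff] at ht
    exact h2.trans (by gcongr)
  refine hunif.tendstoLocallyUniformlyOn.differentiableOn ?_ isOpen_ball
  filter_upwards [self_mem_nhdsWithin, nhdsWithin_le_nhds (Iio_mem_nhds hR)] with δ hδ hδR z hz
  have hδ0 : 0 < δ := hδ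
  have := hprob δ hδ0
  have hder := hasDerivAt_integral_of_dominated_loc_of_lip (μ := μ δ) (𝕜 := ℂ)
    (F := fun z t => F (z + t)) (F' := fun t => deriv F (z + t)) (bound := fun _ => (C : ℝ))
    (x₀ := z) (s := ball c R) (isOpen_ball.mem_nhds hz)
    (Eventually.of_forall fun x => (by fun_prop)) (hint δ hδ z)
    ((measurable_deriv F).comp (measurable_const_add z)).aestronglyMeasurable ?_
    (integrable_const _) ?_
  · exact hder.2.differentiableAt.differentiableWithinAt
  · filter_upwards [hmem δ] with t ht
    refine LipschitzOnWith.of_dist_le_mul fun x hx y hy => ?_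
    have := hL.dist_le_mul _ (hadd (le_of_lt hδR) hx ht) _ (hadd (le_of_lt hδR) hy ht)
    simpa using this
  · have h3 : ∀ᵐ t ∂(volume : Measure ℂ), z + t ∈ ball c (2 * R) →
        DifferentiableAt ℂ F (z + t) :=
      (measurePreserving_add_left volume z).quasiMeasurePreserving.ae hae
    filter_upwards [hmem δ, hac δ h3] with t ht h4
    exact (h4 (hadd (le_of_lt hδR) hz ht)).hasDerivAt.comp_add_const z t

/-- A Phragmén–Lindelöf type estimate in the four quadrants at `z`. -/
theorem norm_sub_le_of_cross {F : ℂ → ℂ} (hFc : Continuous F) {T : Set ℂ} (hT : IsClosed T)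
    {z : ℂ} {r K : ℝ} (hr : 0 < r) (hd : ∀ p ∈ ball z r, p ∉ T → DifferentiableAt ℂ F p)
    (hKT : ∀ p ∈ T ∩ closedBall z r, ‖F p - F z‖ ≤ K * ‖p - z‖)
    (hKre : ∀ t : ℝ, |t| ≤ r → ‖F (z + t) - F z‖ ≤ K * |t|)
    (hKim : ∀ t : ℝ, |t| ≤ r → ‖F (z + t * Complex.I) - F z‖ ≤ K * |t|)
    (hKs : ∀ p ∈ sphere z r, ‖F p - F z‖ ≤ K * ‖p - z‖) {p : ℂ} (hp : p ∈ closedBall z r) :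
    ‖F p - F z‖ ≤ K * ‖p - z‖ := by
  have hK : 0 ≤ K := by
    have := (norm_nonneg _).trans (hKre r (by rw [abs_of_pos hr]))
    rw [abs_of_pos hr] at this
    exact nonneg_of_mul_nonneg_left this hr
  -- The imaginary part of `(q - z) ^ 2` vanishes exactly on the horizontal and vertical lines
  -- through `z`.
  have hcross : ∀ q ∈ closedBall z r, ((q - z) ^ 2).im = 0 → ‖F q - F z‖ ≤ K * ‖q - z‖ := by
    intro q hq h0
    rw [mem_closedBall, dist_eq_norm] at hq
    have h0' : 2 * ((q - z).re * (q - z).im) = 0 := by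
      rw [← h0, pow_two, Complex.mul_im]; ring
    rcases mul_eq_zero.1 ((mul_eq_zero.1 h0').resolve_left two_ne_zero) with h | h
    · have e : q = z + ((q - z).im : ℂ) * Complex.I := by
        apply Complex.ext <;> simp at h ⊢; linarith
      have e2 : q - z = ((q - z).im : ℂ) * Complex.I := by linear_combination e
      have e3 : ‖q - z‖ = |(q - z).im| := by
        conv_lhs => rw [e2]
        rw [norm_mul, Complex.norm_I, mul_one, Complex.norm_real, Real.norm_eq_abs]
      rw [e3] at hq ⊢
      conv_lhs => rw [e]
      exact hKim _ hq
    · have e : q = z + ((q - z).re : ℂ) := by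
        apply Complex.ext <;> simp at h ⊢; linarith
      have e2 : q - z = ((q - z).re : ℂ) := by linear_combination e
      have e3 : ‖q - z‖ = |(q - z).re| := by
        conv_lhs => rw [e2]
        rw [Complex.norm_real, Real.norm_eq_abs]
      rw [e3] at hq ⊢
      conv_lhs => rw [e]
      exact hKre _ hq
  -- the case of a fixed sign of the imaginary part of `(p - z) ^ 2`
  have main : ∀ σ : ℝ, σ ^ 2 = 1 → ∀ q ∈ ball z r, q ∉ T → 0 < σ * ((q - z) ^ 2).im →
      ‖F q - F z‖ ≤ K * ‖q - z‖ := by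
    intro σ hσ q hq hqT hqσ
    set U : Set ℂ := {w | w ∈ ball z r ∧ w ∉ T ∧ 0 < σ * ((w - z) ^ 2).im} with hU
    have hUo : IsOpen U := by
      have h1 : IsOpen {w : ℂ | 0 < σ * ((w - z) ^ 2).im} := isOpen_lt continuous_const
        (continuous_const.mul (Complex.continuous_im.comp (by fun_prop)))
      exact isOpen_ball.inter (hT.isOpen_compl.inter h1)
    have hcl : ∀ w ∈ closure U, w ∈ closedBall z r ∧ 0 ≤ σ * ((w - z) ^ 2).im := by
      intro w hw
      have hc : IsClosed {w : ℂ | w ∈ closedBall z r ∧ 0 ≤ σ * ((w - z) ^ 2).im} := by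
        have h1 : IsClosed {w : ℂ | 0 ≤ σ * ((w - z) ^ 2).im} := isClosed_le continuous_const
          (continuous_const.mul (Complex.continuous_im.comp (by fun_prop)))
        exact isClosed_closedBall.inter h1
      refine closure_minimal ?_ hc hw
      exact fun v hv => ⟨ball_subset_closedBall hv.1, hv.2.2.le⟩
    have hfr : ∀ w ∈ frontier U, ‖F w - F z‖ ≤ K * ‖w - z‖ := by
      intro w hw
      obtain ⟨hw1, hw2⟩ := hcl w hw.1
      have hwU : w ∉ U := by
        have := hw.2
        rwa [hUo.interior_eq] at this
      by_cases hwT : w ∈ T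
      · exact hKT w ⟨hwT, hw1⟩
      by_cases hws : w ∈ sphere z r
      · exact hKs w hws
      have hwb : w ∈ ball z r := by
        rw [mem_closedBall] at hw1; rw [mem_sphere] at hws
        exact lt_of_le_of_ne hw1 hws
      have h0 : σ * ((w - z) ^ 2).im = 0 := by
        refine le_antisymm (not_lt.1 fun h => hwU ⟨hwb, hwT, h⟩) hw2
      refine hcross w hw1 ((mul_eq_zero.1 h0).resolve_left ?_)
      rintro rfl; norm_num at hσ
    -- The quotient `(F w - F z) / (w - z)` need not extend continuously to `z`. Multiplying it by
    -- `(w - z)² / ((w - z)² + iσε)`, of modulus at most 1 on these quadrants, gives a function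
    -- continuous up to `z`. The maximum principle applies to it, and then `ε → 0`.
    have hden : ∀ ε : ℝ, 0 ≤ ε → ∀ w ∈ closure U,
        ‖(w - z) ^ 2‖ ≤ ‖(w - z) ^ 2 + (σ * ε : ℝ) * Complex.I‖ ∧
        (0 < ε → (w - z) ^ 2 + (σ * ε : ℝ) * Complex.I ≠ 0) := by
      intro ε hε w hw
      obtain ⟨-, hw2⟩ := hcl w hw
      constructor
      · rw [← sq_le_sq₀ (norm_nonneg _) (norm_nonneg _), Complex.sq_norm, Complex.sq_norm,
          Complex.normSq_apply, Complex.normSq_apply]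
        simp only [Complex.add_re, Complex.add_im, Complex.re_ofReal_mul, Complex.im_ofReal_mul,
          Complex.I_re, Complex.I_im, mul_zero, add_zero, mul_one]
        nlinarith [mul_nonneg hw2 hε, sq_nonneg (σ * ε)]
      · intro hε0 h0
        have him := congrArg Complex.im h0
        simp only [Complex.add_im, Complex.im_ofReal_mul, Complex.I_im, mul_one,
          Complex.zero_im] at him
        have : σ * ((w - z) ^ 2).im = - ε := by linear_combination σ * him - ε * hσ
        linarith
    have hqz : q - z ≠ 0 := by
      intro h; rw [h] at hqσ; simp at hqσ
    have hbound : ∀ ε : ℝ, 0 < ε →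
        ‖(F q - F z) * (q - z) / ((q - z) ^ 2 + (σ * ε : ℝ) * Complex.I)‖ ≤ K := by
      intro ε hε
      refine Complex.norm_le_of_forall_mem_frontier_norm_le
        (f := fun w => (F w - F z) * (w - z) / ((w - z) ^ 2 + (σ * ε : ℝ) * Complex.I))
        (U := U) (isBounded_ball.subset fun w hw => hw.1) ⟨?_, ?_⟩ ?_
        (subset_closure ⟨hq, hqT, hqσ⟩)
      · intro w hw
        have hne := (hden ε hε.le w (subset_closure hw)).2 hε
        have h1 := hd w hw.1 hw.2.1
        exact (((h1.sub_const _).mul (by fun_prop)).div (by fun_prop) hne).differentiableWithinAt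
      · refine ContinuousOn.div (by fun_prop) (by fun_prop) ?_
        exact fun w hw => (hden ε hε.le w hw).2 hε
      · intro w hw
        have h1 := hden ε hε.le w hw.1
        rw [norm_div, norm_mul, div_le_iff₀ (norm_pos_iff.2 (h1.2 hε))]
        calc ‖F w - F z‖ * ‖w - z‖ ≤ (K * ‖w - z‖) * ‖w - z‖ := by gcongr; exact hfr w hw
          _ = K * ‖(w - z) ^ 2‖ := by rw [norm_pow]; ring
          _ ≤ _ := by gcongr; exact h1.1
    have hlim : Tendsto (fun ε : ℝ =>
        ‖(F q - F z) * (q - z) / ((q - z) ^ 2 + (σ * ε : ℝ) * Complex.I)‖) (𝓝[>] 0)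
        (𝓝 ‖(F q - F z) * (q - z) / ((q - z) ^ 2 + (σ * 0 : ℝ) * Complex.I)‖) := by
      refine Tendsto.mono_left ?_ nhdsWithin_le_nhds
      refine ContinuousAt.tendsto (x := (0 : ℝ)) (f := fun ε : ℝ =>
        ‖(F q - F z) * (q - z) / ((q - z) ^ 2 + (σ * ε : ℝ) * Complex.I)‖) ?_
      refine ContinuousAt.norm (ContinuousAt.div (by fun_prop) (by fun_prop) ?_)
      simpa using hqz
    have h2 := le_of_tendsto hlim (eventually_mem_nhdsWithin.mono fun ε hε => hbound ε hε)
    have e : (F q - F z) * (q - z) / ((q - z) ^ 2 + (σ * 0 : ℝ) * Complex.I) =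
        (F q - F z) / (q - z) := by
      simp only [mul_zero, Complex.ofReal_zero, zero_mul, add_zero]
      field_simp
    rw [e, norm_div, div_le_iff₀ (norm_pos_iff.2 hqz)] at h2
    exact h2
  by_cases hpT : p ∈ T
  · exact hKT p ⟨hpT, hp⟩
  by_cases hps : p ∈ sphere z r
  · exact hKs p hps
  have hpb : p ∈ ball z r := by
    rw [mem_closedBall] at hp; rw [mem_sphere] at hps
    exact lt_of_le_of_ne hp hps
  rcases lt_trichotomy ((p - z) ^ 2).im 0 with h | h | h
  · exact main (-1) (by norm_num) p hpb hpT (by linarith)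
  · exact hcross p hp h
  · exact main 1 (by norm_num) p hpb hpT (by linarith)

theorem HasDerivAt.exists_nat_norm_sub_le {f : ℝ → ℂ} {f' : ℂ} (h : HasDerivAt f f' 0) :
    ∃ N : ℕ, ∀ n : ℕ, N ≤ n → ∀ t : ℝ, |t| ≤ 1 / ((n : ℝ) + 1) → ‖f t - f 0‖ ≤ n * |t| := by
  obtain ⟨c, hc⟩ := h.isBigO_sub.bound
  obtain ⟨δ, hδ, hball⟩ := Metric.eventually_nhds_iff.1 hc
  obtain ⟨N₁, hN₁⟩ := exists_nat_ge c
  obtain ⟨N₂, hN₂⟩ := exists_nat_one_div_lt hδ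
  refine ⟨max N₁ N₂, fun n hn t ht => ?_⟩
  have h1 : dist t 0 < δ := by
    rw [Real.dist_eq, sub_zero]
    refine (ht.trans ?_).trans_lt hN₂
    have : (N₂ : ℝ) ≤ n := by exact_mod_cast (le_max_right _ _).trans hn
    gcongr
  have h2 := hball h1
  rw [sub_zero, Real.norm_eq_abs] at h2
  refine h2.trans ?_
  have : (N₁ : ℝ) ≤ n := by exact_mod_cast (le_max_left _ _).trans hn
  gcongr
  exact hN₁.trans this

theorem HasCauchyRiemannAt.congr {F G : ℂ → ℂ} {z : ℂ} (h : HasCauchyRiemannAt F z)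
    (hFG : G =ᶠ[𝓝 z] F) : HasCauchyRiemannAt G z := by
  obtain ⟨g, h1, h2⟩ := h
  have key : ∀ w : ℂ, (fun t : ℝ => G (z + t * w)) =ᶠ[𝓝 0] fun t : ℝ => F (z + t * w) := by
    intro w
    have hc : Tendsto (fun t : ℝ => z + (t : ℂ) * w) (𝓝 0) (𝓝 z) := by
      have : Continuous fun t : ℝ => z + (t : ℂ) * w := by fun_prop
      simpa using this.tendsto 0
    exact hc.eventually hFG
  exact ⟨g, h1.congr_of_eventuallyEq (by simpa using key 1), h2.congr_of_eventuallyEq (key _)⟩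

/-- If the closed set `T` of non-analytic points meets `U`, Baire's theorem gives a portion of `T`
on which the horizontal and vertical difference quotients are uniformly bounded. This makes `F`
Lipschitz on that portion, then between points of `T` and arbitrary nearby points, then on a whole
disc. The Lipschitz case makes `F` analytic at a point of `T`, a contradiction. -/
theorem analyticAt_of_continuous_of_cauchyRiemann {F : ℂ → ℂ} (hFc : Continuous F) {U : Set ℂ}
    (hU : IsOpen U) (hCR : ∀ z ∈ U, HasCauchyRiemannAt F z) {z₀ : ℂ} (hz₀ : z₀ ∈ U) :
    AnalyticAt ℂ F z₀ := by
  set T : Set ℂ := {z | ¬ AnalyticAt ℂ F z} with hTdef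
  have hT : IsClosed T := by
    have := (isOpen_analyticAt ℂ F).isClosed_compl
    exact this
  by_contra hz₀T
  -- One index bounds both the slope and the scale, so countably many closed sets cover `U`.
  let E : ℕ → Set ℂ := fun n => {z | ∀ t : ℝ, |t| ≤ 1 / ((n : ℝ) + 1) →
    ‖F (z + t) - F z‖ ≤ n * |t| ∧ ‖F (z + t * Complex.I) - F z‖ ≤ n * |t|}
  have hE : ∀ n, IsClosed (E n) := by
    intro n
    simp only [E, Set.ofPred_forall]
    refine isClosed_iInter fun t => isClosed_iInter fun _ => ?_
    have h1 : ∀ w : ℂ, IsClosed {z : ℂ | ‖F (z + w) - F z‖ ≤ n * |t|} := fun w =>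
      isClosed_le (by fun_prop) (by fun_prop)
    exact (h1 _).inter (h1 _)
  have hcover : ∀ z ∈ U, ∃ n, z ∈ E n := by
    intro z hz
    obtain ⟨g, h1, h2⟩ := hCR z hz
    obtain ⟨N₁, hN₁⟩ := HasDerivAt.exists_nat_norm_sub_le h1
    obtain ⟨N₂, hN₂⟩ := HasDerivAt.exists_nat_norm_sub_le h2
    refine ⟨max N₁ N₂, fun t ht => ⟨?_, ?_⟩⟩
    · simpa using hN₁ _ (le_max_left _ _) t ht
    · simpa using hN₂ _ (le_max_right _ _) t ht
  have : LocallyCompactSpace ↥(U ∩ T) :=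
    (hU.isLocallyClosed.inter hT.isLocallyClosed).locallyCompactSpace
  have : Nonempty ↥(U ∩ T) := ⟨⟨z₀, hz₀, hz₀T⟩⟩
  obtain ⟨n, ⟨s₀, hs₀U, hs₀T⟩, hs₀⟩ := nonempty_interior_of_iUnion_of_closed
    (f := fun n => ((↑) : ↥(U ∩ T) → ℂ) ⁻¹' E n)
    (fun n => (hE n).preimage continuous_subtype_val) (by
      refine Set.eq_univ_of_forall fun x => Set.mem_iUnion.2 ?_
      exact hcover x x.2.1)
  obtain ⟨V, hVE, hVo, hsV⟩ := mem_interior.1 hs₀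
  obtain ⟨W, hW, rfl⟩ := isOpen_induced_iff.1 hVo
  have hWE : ∀ z ∈ W, z ∈ U → z ∈ T → z ∈ E n := fun z hz hzU hzT =>
    @hVE ⟨z, hzU, hzT⟩ hz
  obtain ⟨ρ, hρ, hρWU⟩ := Metric.nhds_basis_closedBall.mem_iff.1
    ((hW.inter hU).mem_nhds ⟨hsV, hs₀U⟩)
  have hn1 : 0 < 1 / ((n : ℝ) + 1) := by positivity
  obtain ⟨r, hr, hrρ, hrn⟩ : ∃ r : ℝ, 0 < r ∧ 2 * r ≤ ρ ∧ 4 * r ≤ 1 / ((n : ℝ) + 1) :=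
    ⟨min (ρ / 2) (1 / ((n : ℝ) + 1) / 4), by positivity,
      by linarith [min_le_left (ρ / 2) (1 / ((n : ℝ) + 1) / 4)],
      by linarith [min_le_right (ρ / 2) (1 / ((n : ℝ) + 1) / 4)]⟩
  have hTE : ∀ z ∈ T, z ∈ closedBall s₀ (2 * r) → z ∈ E n := fun z hzT hz =>
    hWE z (hρWU (closedBall_subset_closedBall hrρ hz)).1
      (hρWU (closedBall_subset_closedBall hrρ hz)).2 hzT
  -- Move horizontally from `z` and vertically from `w` to a common corner. The corner need not lie
  -- in `T`, since each estimate is based at a point of `T`.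
  have hLT : ∀ z ∈ T, z ∈ closedBall s₀ (2 * r) → ∀ w ∈ T, w ∈ closedBall s₀ (2 * r) →
      ‖F w - F z‖ ≤ 2 * n * ‖w - z‖ := by
    intro z hzT hz w hwT hw
    have hd : ‖w - z‖ ≤ 4 * r := by
      rw [← dist_eq_norm]
      rw [mem_closedBall] at hz hw
      linarith [dist_triangle_right w z s₀]
    have hre := Complex.abs_re_le_norm (w - z)
    have him := Complex.abs_im_le_norm (w - z)
    have h1 := (hTE z hzT hz (w - z).re (by linarith)).1
    have h2 := (hTE w hwT hw (-(w - z).im) (by rw [abs_neg]; linarith)).2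
    have e : w + ((-(w - z).im : ℝ) : ℂ) * Complex.I = z + ((w - z).re : ℂ) := by
      have := Complex.re_add_im (w - z)
      push_cast at this ⊢
      linear_combination -this
    rw [e, abs_neg] at h2
    have h3 : F w - F z = (F (z + ((w - z).re : ℂ)) - F z) - (F (z + ((w - z).re : ℂ)) - F w) := by
      ring
    rw [h3]
    refine (norm_sub_le _ _).trans ?_
    have hn0 : (0 : ℝ) ≤ n := n.cast_nonneg
    nlinarith
  obtain ⟨M, hM⟩ := ((isCompact_closedBall s₀ (2 * r)).image hFc).isBounded.exists_norm_le
  have hM' : ∀ p ∈ closedBall s₀ (2 * r), ‖F p‖ ≤ M := fun p hp => hM _ ⟨p, hp, rfl⟩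
  -- The first entry controls points of `T`; the second controls the circle of radius `r`, where the
  -- increment is at most `2 * M`.
  set K : ℝ := max (2 * n) (2 * M / r) with hK
  have hK0 : 0 ≤ K := le_max_of_le_left (by positivity)
  have hnK : (n : ℝ) ≤ K := by
    have : (0 : ℝ) ≤ n := n.cast_nonneg
    exact le_trans (by linarith) (le_max_left _ _)
  have hLK : ∀ z ∈ T, z ∈ ball s₀ r → ∀ p ∈ closedBall z r, ‖F p - F z‖ ≤ K * ‖p - z‖ := by
    intro z hzT hz p hp
    have hsub : closedBall z r ⊆ closedBall s₀ (2 * r) := by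
      refine closedBall_subset_closedBall' ?_
      rw [mem_ball] at hz; linarith
    have hz2 : z ∈ closedBall s₀ (2 * r) := hsub (mem_closedBall_self hr.le)
    refine norm_sub_le_of_cross hFc hT hr (fun q _ hq => (not_not.1 hq).differentiableAt)
      ?_ ?_ ?_ ?_ hp
    · intro q hq
      refine (hLT z hzT hz2 q hq.1 (hsub hq.2)).trans ?_
      gcongr
      exact le_max_left _ _
    · intro t ht
      exact ((hTE z hzT hz2 t (by linarith)).1).trans (by gcongr)
    · intro t ht
      exact ((hTE z hzT hz2 t (by linarith)).2).trans (by gcongr)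
    · intro q hq
      have h1 := hM' q (hsub (sphere_subset_closedBall hq))
      have h2 := hM' z hz2
      rw [mem_sphere, dist_eq_norm] at hq
      rw [hq]
      have h3 : 2 * M ≤ K * r := (div_le_iff₀ hr).1 (le_max_right _ _)
      linarith [norm_sub_le (F q) (F z)]
  -- Off `T`, Cauchy's estimate on the circle of half the distance to the nearest `z ∈ T` bounds the
  -- derivative by `3 * K`, because that circle lies within three half-distances of `z`. The extra 1
  -- absorbs the little-o remainder.
  have hLip : LipschitzOnWith (Real.toNNReal (3 * K + 1)) F (ball s₀ (2 * (r / 8))) := by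
    refine lipschitzOnWith_ball_of_eventually hFc.continuousOn fun p hp => ?_
    rw [Real.coe_toNNReal _ (by positivity)]
    rw [mem_ball] at hp
    by_cases hpT : p ∈ T
    · filter_upwards [closedBall_mem_nhds p hr] with q hq
      refine (hLK p hpT (by rw [mem_ball]; linarith) q hq).trans ?_
      gcongr
      linarith
    · obtain ⟨z, hzT, hz⟩ := hT.exists_infDist_eq_dist ⟨s₀, hs₀T⟩ p
      have hds : dist p z ≤ dist p s₀ := hz ▸ infDist_le_dist_of_mem hs₀T
      have hd0 : 0 < dist p z := dist_pos.2 fun h => hpT (h ▸ hzT)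
      have hoff : ∀ q ∈ ball p (dist p z), q ∉ T := by
        intro q hq hqT
        have := infDist_le_dist_of_mem (x := p) hqT
        rw [mem_ball, dist_comm] at hq
        linarith
      have hzb : z ∈ ball s₀ r := by
        rw [mem_ball]
        linarith [dist_triangle_left z s₀ p]
      have hda : ∀ q ∈ ball p (dist p z), DifferentiableAt ℂ F q := fun q hq =>
        (not_not.1 (hoff q hq)).differentiableAt
      have hder : ‖deriv (fun w => F w - F z) p‖ ≤ K * (3 * (dist p z / 2)) / (dist p z / 2) := by
        refine Complex.norm_deriv_le_of_forall_mem_sphere_norm_le (half_pos hd0) ?_ ?_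
        · refine DifferentiableOn.diffContOnCl_ball (U := ball p (dist p z)) ?_
            (closedBall_subset_ball (half_lt_self hd0))
          exact fun q hq => ((hda q hq).sub_const _).differentiableWithinAt
        · intro w hw
          rw [mem_sphere] at hw
          have hwz : dist w z ≤ 3 * (dist p z / 2) := by linarith [dist_triangle w p z]
          refine (hLK z hzT hzb w ?_).trans ?_
          · rw [mem_closedBall]; linarith
          · rw [← dist_eq_norm]; gcongr
      rw [deriv_sub_const, ← mul_assoc, mul_div_assoc, div_self (half_pos hd0).ne', mul_one]
        at hder
      have hd := (hda p (mem_ball_self hd0)).hasDerivAt.isLittleO.bound one_pos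
      filter_upwards [hd] with q hq
      have h1 := norm_add_le (F q - F p - (q - p) • deriv F p) ((q - p) • deriv F p)
      rw [sub_add_cancel, norm_smul] at h1
      nlinarith [norm_nonneg (q - p)]
  have hdiff := differentiableOn_of_lipschitzOnWith_of_cauchyRiemann hFc hLip (fun z hz => by
    refine hCR z (hρWU (?_ : z ∈ closedBall s₀ ρ)).2
    rw [mem_ball] at hz
    rw [mem_closedBall]; linarith)
  exact hs₀T (hdiff.analyticAt (ball_mem_nhds s₀ (by positivity)))

/-- The **Looman–Menchoff theorem**. -/
theorem differentiableOn_of_continuousOn_of_cauchyRiemann {F : ℂ → ℂ} {U : Set ℂ}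
    (hFc : ContinuousOn F U) (hU : IsOpen U) (hCR : ∀ z ∈ U, HasCauchyRiemannAt F z) :
    DifferentiableOn ℂ F U := by
  intro z hz
  obtain ⟨ρ, hρ, hρU⟩ := Metric.nhds_basis_closedBall.mem_iff.1 (hU.mem_nhds hz)
  -- Tietze extension supplies the global continuity assumed so far.
  obtain ⟨G, hG⟩ := ContinuousMap.exists_restrict_eq (isClosed_closedBall (x := z) (ε := ρ))
    ⟨_, (hFc.mono hρU).domRestrict⟩
  have hGF : Set.EqOn G F (closedBall z ρ) := fun w hw =>
    congrArg (fun f : C(closedBall z ρ, ℂ) => f ⟨w, hw⟩) hG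
  have hev : ∀ w ∈ ball z ρ, G =ᶠ[𝓝 w] F := fun w hw =>
    (hGF.mono ball_subset_closedBall).eventuallyEq_of_mem (isOpen_ball.mem_nhds hw)
  have := analyticAt_of_continuous_of_cauchyRiemann G.continuous isOpen_ball
    (fun w hw => (hCR w (hρU (ball_subset_closedBall hw))).congr (hev w hw))
    (mem_ball_self (x := z) hρ)
  exact (this.differentiableAt.congr_of_eventuallyEq
    (hev z (mem_ball_self hρ)).symm).differentiableWithinAt

end LoomanMenchoff

theorem continuousSMul_real {A : Type*} [CommRing A] [Algebra ℂ A] [TopologicalSpace A]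
    [ContinuousSMul ℂ A] : ContinuousSMul ℝ A := by
  refine ⟨?_⟩
  have : (fun p : ℝ × A => p.1 • p.2) = fun p : ℝ × A => (p.1 : ℂ) • p.2 := by
    ext p; exact (Complex.coe_smul p.1 p.2).symm
  rw [this]
  fun_prop

/-! ### Characters and ideals of a finite-dimensional algebra. -/

section Algebra

variable {A : Type*} [CommRing A] [Algebra ℂ A] [FiniteDimensional ℂ A]

/-- A maximal ideal of a finite-dimensional complex algebra is the kernel of a character. -/
theorem exists_algHom_ker_eq (I : Ideal A) [I.IsMaximal] :
    ∃ f : A →ₐ[ℂ] ℂ, RingHom.ker f = I := by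
  let _ : Field (A ⧸ I) := Ideal.Quotient.field I
  have : FiniteDimensional ℂ (A ⧸ I) :=
    Module.Finite.of_surjective (Ideal.Quotient.mkₐ ℂ I).toLinearMap
      (Ideal.Quotient.mkₐ_surjective ℂ I)
  let φ : A ⧸ I →ₐ[ℂ] ℂ := IsAlgClosed.lift
  refine ⟨φ.comp (Ideal.Quotient.mkₐ ℂ I), ?_⟩
  ext x
  rw [RingHom.mem_ker, AlgHom.comp_apply, map_eq_zero_iff φ φ.toRingHom.injective]
  exact Ideal.Quotient.eq_zero_iff_mem

/-- A non-zero ideal has a quotient on which the algebra acts through a character. -/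
theorem exists_functional_of_ideal_ne_bot {J : Ideal A} (hJ : J ≠ ⊥) :
    ∃ (f : A →ₐ[ℂ] ℂ) (l : A →ₗ[ℂ] ℂ), (∀ a, ∀ x ∈ J, l (a * x) = f a * l x) ∧
      ∃ b ∈ J, l b = 1 := by
  have : IsArtinianRing A := IsArtinianRing.of_finite ℂ A
  have : IsNoetherianRing A := inferInstance
  have : Nontrivial J := Submodule.nontrivial_iff_ne_bot.2 hJ
  obtain ⟨N, hN⟩ := IsCoatomic.exists_coatom (Submodule A J)
  have hs : IsSimpleModule A (J ⧸ N) := isSimpleModule_iff_isCoatom.2 hN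
  obtain ⟨I, hI, ⟨φ⟩⟩ := isSimpleModule_iff_quot_maximal.1 hs
  obtain ⟨f, hf⟩ := exists_algHom_ker_eq I
  let ψ : A ⧸ I →+* ℂ := Ideal.Quotient.lift I f.toRingHom fun a ha => by
    rw [← hf] at ha; exact ha
  let q : J →ₗ[A] A ⧸ I := φ.toLinearMap ∘ₗ N.mkQ
  have hψ : ∀ a (y : A ⧸ I), ψ (a • y) = f a * ψ y := by
    intro a y
    rw [Algebra.smul_def, map_mul]; rfl
  let l₀ : J.restrictScalars ℂ →ₗ[ℂ] ℂ :=
    { toFun := fun x => ψ (q x)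
      map_add' := fun x y => by
        have : q (x + y : J) = q x + q y := map_add q _ _
        exact (congrArg ψ this).trans (map_add ψ _ _)
      map_smul' := fun c x => by
        have h1 : q ((algebraMap ℂ A c) • (x : J) : J) = (algebraMap ℂ A c) • q x :=
          map_smul q _ _
        have h2 : (c • x : J.restrictScalars ℂ) = ((algebraMap ℂ A c) • (x : J) : J) := by
          apply Subtype.ext
          exact Algebra.smul_def c (x : A)
        rw [h2, RingHom.id_apply, smul_eq_mul]
        refine (congrArg ψ h1).trans ?_
        rw [hψ, AlgHom.commutes]; rfl }
  -- The extension from `J` to `A` is merely linear; equivariance survives only on `J`.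
  obtain ⟨l, hl⟩ := l₀.exists_extend
  have hl' : ∀ x (hx : x ∈ J), l x = ψ (q ⟨x, hx⟩) := fun x hx =>
    LinearMap.congr_fun hl ⟨x, hx⟩
  refine ⟨f, l, ?_, ?_⟩
  · intro a x hx
    rw [hl' x hx, hl' _ (J.mul_mem_left a hx), ← hψ, ← map_smul]
    rfl
  · have hq : Function.Surjective q := φ.surjective.comp N.mkQ_surjective
    obtain ⟨x, hx⟩ := hq 1
    exact ⟨x, x.2, by rw [hl' x x.2]; exact (congrArg ψ hx).trans (map_one ψ)⟩

/-- The powers of `I = ker f` stabilise, so `I ^ N = I * I ^ N`, and Nakayama's lemma gives an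
element congruent to 1 modulo `I` that kills `I ^ N`. It plays the role of the idempotent belonging
to `f`. -/
theorem exists_eq_one_and_mul_pow_eq_zero (f : A →ₐ[ℂ] ℂ) :
    ∃ (c : A) (N : ℕ), f c = 1 ∧ ∀ x : A, f x = 0 → c * x ^ N = 0 := by
  have : IsArtinianRing A := IsArtinianRing.of_finite ℂ A
  have : IsNoetherianRing A := inferInstance
  let I : Ideal A := RingHom.ker f
  obtain ⟨N, hN⟩ := IsArtinian.monotone_stabilizes
    ⟨fun n => OrderDual.toDual (I ^ n), fun m n h => Ideal.pow_le_pow_right h⟩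
  have hN1 : I ^ N = I ^ (N + 1) := hN (N + 1) N.le_succ
  obtain ⟨r, hr, hr0⟩ := Submodule.exists_sub_one_mem_and_smul_eq_zero_of_fg_of_le_smul I (I ^ N)
    (IsNoetherian.noetherian _) (by rw [smul_eq_mul, ← pow_succ', ← hN1])
  refine ⟨r, N, ?_, fun x hx => hr0 _ (Ideal.pow_mem_pow hx N)⟩
  have : f (r - 1) = 0 := hr
  rwa [map_sub, map_one, sub_eq_zero] at this

theorem finite_algHom : Finite (A →ₐ[ℂ] ℂ) :=
  (linearIndependent_algHom_toLinearMap ℂ A ℂ).finite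

variable [TopologicalSpace A] [IsTopologicalAddGroup A] [ContinuousSMul ℂ A] [T2Space A]

theorem isTopologicalRing : IsTopologicalRing A := by
  have : IsModuleTopology ℂ A := isModuleTopologyOfFiniteDimensional
  exact IsModuleTopology.isTopologicalRing ℂ A

end Algebra

/-! ### Calculus of one-sided derivatives with values in the algebra. -/

section RightDerivative

variable {A : Type*} [CommRing A] [Algebra ℂ A] [TopologicalSpace A]

/-- The right derivative of `u` at `0` is `u'`. -/
def HasRightDeriv (u : ℝ → A) (u' : A) : Prop :=
  Tendsto (fun ε : ℝ => ε⁻¹ • (u ε - u 0)) (𝓝[>] (0 : ℝ)) (𝓝 u')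

theorem HasRightDeriv.const (a : A) : HasRightDeriv (fun _ => a) 0 := by
  simp only [HasRightDeriv, sub_self, smul_zero]
  exact tendsto_const_nhds

theorem HasRightDeriv.affine (a b : A) : HasRightDeriv (fun ε => a + ε • b) b := by
  refine (tendsto_const_nhds (x := b)).congr' ?_
  filter_upwards [self_mem_nhdsWithin] with ε hε
  have hε' : ε ≠ 0 := ne_of_gt hε
  simp [inv_smul_smul₀ hε']

theorem HasRightDeriv.algebraMap [ContinuousSMul ℂ A] {g : ℝ → ℂ} {g' : ℂ}
    (h : HasDerivAt g g' 0) :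
    HasRightDeriv (fun ε => algebraMap ℂ A (g ε)) (algebraMap ℂ A g') := by
  have h1 := (hasDerivAt_iff_tendsto_slope_left_right.1 h).2
  refine (((continuous_algebraMap ℂ A).tendsto g').comp h1).congr fun ε => ?_
  simp only [Function.comp, slope, vsub_eq_sub, sub_zero]
  rw [← Complex.coe_smul, smul_eq_mul, map_mul, map_sub, ← Algebra.smul_def, Complex.coe_smul]

variable [IsTopologicalRing A]

theorem HasRightDeriv.sum {ι : Type*} (s : Finset ι) {u : ι → ℝ → A} {u' : ι → A}
    (h : ∀ i ∈ s, HasRightDeriv (u i) (u' i)) :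
    HasRightDeriv (fun ε => ∑ i ∈ s, u i ε) (∑ i ∈ s, u' i) := by
  refine (tendsto_finsetSum s h).congr fun ε => ?_
  rw [← Finset.sum_sub_distrib, Finset.smul_sum]

variable [ContinuousSMul ℝ A]

theorem HasRightDeriv.tendsto {u : ℝ → A} {u' : A} (h : HasRightDeriv u u') :
    Tendsto u (𝓝[>] (0 : ℝ)) (𝓝 (u 0)) := by
  have hid : Tendsto (fun ε : ℝ => ε) (𝓝[>] (0 : ℝ)) (𝓝 0) := nhdsWithin_le_nhds
  have h1 := (hid.smul h).add_const (u 0)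
  rw [zero_smul, zero_add] at h1
  refine h1.congr' ?_
  filter_upwards [self_mem_nhdsWithin] with ε hε
  have hε' : ε ≠ 0 := ne_of_gt hε
  rw [smul_inv_smul₀ hε', sub_add_cancel]

theorem HasRightDeriv.mul {u v : ℝ → A} {u' v' : A} (hu : HasRightDeriv u u')
    (hv : HasRightDeriv v v') :
    HasRightDeriv (fun ε => u ε * v ε) (u' * v 0 + u 0 * v') := by
  refine ((Tendsto.mul hu hv.tendsto).add (Tendsto.mul tendsto_const_nhds hv)).congr fun ε => ?_
  rw [smul_mul_assoc, mul_smul_comm, ← smul_add]; congr 1; ring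

theorem HasRightDeriv.pow {u : ℝ → A} {u' : A} (hu : HasRightDeriv u u') (n : ℕ) :
    HasRightDeriv (fun ε => u ε ^ n) (n * u 0 ^ (n - 1) * u') := by
  induction n with
  | zero => simpa using HasRightDeriv.const (1 : A)
  | succ n ih =>
    have := ih.mul hu
    simp only [← pow_succ] at this
    convert this using 1
    rcases n with _ | n
    · simp
    · simp only [Nat.add_sub_cancel]; push_cast; ring

end RightDerivative

/-- Monogenicity only gives limits as `ε → 0+`; opposite directions combine into a two-sided
derivative. -/
theorem hasDerivAt_of_right_slopes {u : ℝ → ℂ} {g : ℂ}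
    (h1 : Tendsto (fun ε : ℝ => ε⁻¹ • (u ε - u 0)) (𝓝[>] (0 : ℝ)) (𝓝 g))
    (h2 : Tendsto (fun ε : ℝ => ε⁻¹ • (u (-ε) - u 0)) (𝓝[>] (0 : ℝ)) (𝓝 (-g))) :
    HasDerivAt u g 0 := by
  rw [hasDerivAt_iff_tendsto_slope_left_right]
  constructor
  · have hneg : Tendsto (fun ε : ℝ => -ε) (𝓝[<] 0) (𝓝[>] 0) := by
      simpa using tendsto_neg_nhdsLT (a := (0 : ℝ))
    have h3 := (h2.comp hneg).neg
    rw [neg_neg] at h3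
    refine h3.congr fun ε => ?_
    simp [slope, inv_neg]
  · exact h1.congr fun ε => by simp [slope]

/-! ### Monogenic functions, their holomorphic components and their extension. -/

section Monogenic

variable {A : Type*} [CommRing A] [Algebra ℂ A] {E : Submodule ℝ A} {Ω : Set E}

theorem subset_bigPi : Ω ⊆ bigPi Ω := fun ζ hζ _ => ⟨ζ, hζ, rfl⟩

variable [TopologicalSpace A] {Φ Ψ : E → A}

theorem MonogenicOn.mono {Ω' : Set E} (h : MonogenicOn Φ Ω) (hs : Ω' ⊆ Ω) :
    MonogenicOn Φ Ω' :=
  ⟨h.1.mono hs, fun ζ hζ => h.2 ζ (hs hζ)⟩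

variable [IsTopologicalAddGroup A]

theorem MonogenicOn.add (h : MonogenicOn Φ Ω) (h' : MonogenicOn Ψ Ω) :
    MonogenicOn (fun ζ => Φ ζ + Ψ ζ) Ω := by
  refine ⟨h.1.add h'.1, fun ζ hζ => ?_⟩
  obtain ⟨a, ha⟩ := h.2 ζ hζ
  obtain ⟨b, hb⟩ := h'.2 ζ hζ
  refine ⟨a + b, fun v => ?_⟩
  rw [mul_add]
  refine ((ha v).add (hb v)).congr fun ε => ?_
  rw [← smul_add]; congr 1; ring

theorem MonogenicOn.sub (h : MonogenicOn Φ Ω) (h' : MonogenicOn Ψ Ω) :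
    MonogenicOn (fun ζ => Φ ζ - Ψ ζ) Ω := by
  refine ⟨h.1.sub h'.1, fun ζ hζ => ?_⟩
  obtain ⟨a, ha⟩ := h.2 ζ hζ
  obtain ⟨b, hb⟩ := h'.2 ζ hζ
  refine ⟨a - b, fun v => ?_⟩
  rw [mul_sub]
  refine ((ha v).sub (hb v)).congr fun ε => ?_
  rw [← smul_sub]; congr 1; ring

variable [ContinuousSMul ℂ A]

theorem tendsto_line (ζ h : E) : Tendsto (fun ε : ℝ => ζ + ε • h) (𝓝[>] 0) (𝓝 ζ) := by
  have := continuousSMul_real (A := A)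
  have h1 : Continuous fun ε : ℝ => ζ + ε • h := by fun_prop
  have h2 := h1.tendsto 0
  rw [zero_smul, add_zero] at h2
  exact h2.mono_left nhdsWithin_le_nhds

theorem isOpenMap_algHom_restrict (f : A →ₐ[ℂ] ℂ)
    (hf : Set.range (fun ζ : E => f (ζ : A)) = Set.univ) :
    IsOpenMap (fun ζ : E => f (ζ : A)) := by
  have := continuousSMul_real (A := A)
  exact ((f.toLinearMap.restrictScalars ℝ).comp E.subtype).isOpenMap_of_finiteDimensional
    (Set.range_eq_univ.1 hf)

theorem isOpen_imageD (f : A →ₐ[ℂ] ℂ) (hf : Set.range (fun ζ : E => f (ζ : A)) = Set.univ)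
    (hΩ : IsOpen Ω) : IsOpen (imageD f Ω) :=
  isOpenMap_algHom_restrict f hf _ hΩ

variable [FiniteDimensional ℂ A] [T2Space A]

theorem continuous_algHom (f : A →ₐ[ℂ] ℂ) : Continuous f :=
  f.toLinearMap.continuous_of_finiteDimensional

theorem isOpen_bigPi (hf : ∀ f : A →ₐ[ℂ] ℂ, Set.range (fun ζ : E => f (ζ : A)) = Set.univ)
    (hΩ : IsOpen Ω) : IsOpen (bigPi Ω) := by
  have := finite_algHom (A := A)
  have e : bigPi Ω = ⋂ f : A →ₐ[ℂ] ℂ, (fun ζ : E => f (ζ : A)) ⁻¹' imageD f Ω := by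
    ext ζ; simp [bigPi]
  rw [e]
  exact isOpen_iInter_of_finite fun f => (isOpen_imageD f (hf f) hΩ).preimage
    ((continuous_algHom f).comp continuous_subtype_val)

/-- If a monogenic function has values in an ideal, so does its derivative; hence a functional
which is equivariant on the ideal turns the Gateaux derivative into a complex one. -/
theorem MonogenicOn.exists_functional_deriv (hE : (1 : A) ∈ E) (hΩ : IsOpen Ω)
    (hΦ : MonogenicOn Φ Ω) {J : Ideal A} (hJ : ∀ ζ ∈ Ω, Φ ζ ∈ J) {f : A →ₐ[ℂ] ℂ}
    {l : A →ₗ[ℂ] ℂ} (hl : ∀ a, ∀ x ∈ J, l (a * x) = f a * l x) {ζ : E} (hζ : ζ ∈ Ω) :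
    ∃ g : ℂ, ∀ h : E, Tendsto (fun ε : ℝ => ε⁻¹ • (l (Φ (ζ + ε • h)) - l (Φ ζ)))
      (𝓝[>] (0 : ℝ)) (𝓝 (f (h : A) * g)) := by
  have := continuousSMul_real (A := A)
  obtain ⟨Φ', hΦ'⟩ := hΦ.2 ζ hζ
  have hmem : Φ' ∈ J.restrictScalars ℝ := by
    have hc : IsClosed ((J.restrictScalars ℝ : Submodule ℝ A) : Set A) :=
      Submodule.closed_of_finiteDimensional _
    have h1 := hΦ' ⟨1, hE⟩
    rw [one_mul] at h1
    refine hc.mem_of_tendsto h1 ?_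
    filter_upwards [tendsto_line ζ ⟨1, hE⟩ (hΩ.mem_nhds hζ)] with ε hε
    exact Submodule.smul_mem _ _ (J.sub_mem (hJ _ hε) (hJ _ hζ))
  refine ⟨l Φ', fun h => ?_⟩
  rw [← hl _ _ hmem]
  refine ((l.continuous_of_finiteDimensional.tendsto _).comp (hΦ' h)).congr fun ε => ?_
  simp only [Function.comp]
  rw [← Complex.coe_smul, map_smul, map_sub, Complex.coe_smul]

/-- On a segment inside a fibre of `f`, the right derivative of `l ∘ Φ` is zero, so `l ∘ Φ` descends
to `f(Ω)`. Openness of `f` on `E` transfers continuity. Surjectivity realises every direction `w` as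
some `f h`, so the derivative of `F` along `w` is `w * g` with one `g`, which is the Cauchy–Riemann
equation. -/
theorem MonogenicOn.exists_holomorphic (hE : (1 : A) ∈ E) (hΩ : IsOpen Ω)
    (hΦ : MonogenicOn Φ Ω) {J : Ideal A} (hJ : ∀ ζ ∈ Ω, Φ ζ ∈ J) {f : A →ₐ[ℂ] ℂ}
    {l : A →ₗ[ℂ] ℂ} (hl : ∀ a, ∀ x ∈ J, l (a * x) = f a * l x)
    (hconv : ConvexWrt Ω (directions E f))
    (hf : Set.range (fun ζ : E => f (ζ : A)) = Set.univ) :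
    ∃ F : ℂ → ℂ, DifferentiableOn ℂ F (imageD f Ω) ∧ ∀ ζ ∈ Ω, F (f (ζ : A)) = l (Φ ζ) := by
  have := continuousSMul_real (A := A)
  have hlc : Continuous l := l.continuous_of_finiteDimensional
  have hconst : ∀ ζ₁ ∈ Ω, ∀ ζ₂ ∈ Ω, f (ζ₂ : A) = f (ζ₁ : A) → l (Φ ζ₂) = l (Φ ζ₁) := by
    intro ζ₁ h₁ ζ₂ h₂ h12
    have hd : f ((ζ₂ - ζ₁ : E) : A) = 0 := by
      rw [Submodule.coe_sub, map_sub, h12, sub_self]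
    have hseg := hconv ζ₁ h₁ ζ₂ h₂ hd
    have key := constant_of_has_deriv_right_zero (a := 0) (b := 1)
      (f := fun t : ℝ => l (Φ (ζ₁ + t • (ζ₂ - ζ₁)))) ?_ ?_ 1 (by simp)
    · simpa using key
    · refine hlc.comp_continuousOn (hΦ.1.comp ?_ hseg)
      exact Continuous.continuousOn (by fun_prop)
    · intro t ht
      obtain ⟨g, hg⟩ := hΦ.exists_functional_deriv hE hΩ hJ hl (hseg t ⟨ht.1, ht.2.le⟩)
      have h3 := hg (ζ₂ - ζ₁)
      rw [hd, zero_mul] at h3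
      rw [← hasDerivWithinAt_Ioi_iff_Ici, hasDerivWithinAt_iff_tendsto_slope' Set.self_notMem_Ioi]
      have hsub : Tendsto (fun s : ℝ => s - t) (𝓝[>] t) (𝓝[>] 0) := by
        refine tendsto_nhdsWithin_iff.2 ⟨?_, ?_⟩
        · have : Continuous fun s : ℝ => s - t := by fun_prop
          have h4 := this.tendsto t
          rw [sub_self] at h4
          exact h4.mono_left nhdsWithin_le_nhds
        · filter_upwards [self_mem_nhdsWithin] with s hs
          exact Set.mem_Ioi.2 (sub_pos.2 (Set.mem_Ioi.1 hs))
      refine (h3.comp hsub).congr fun s => ?_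
      simp only [Function.comp, slope, vsub_eq_sub]
      rw [add_assoc, ← add_smul, add_sub_cancel]
  classical
  let F : ℂ → ℂ := fun z => if h : ∃ ζ ∈ Ω, f (ζ : A) = z then l (Φ h.choose) else 0
  have hF : ∀ ζ ∈ Ω, F (f (ζ : A)) = l (Φ ζ) := by
    intro ζ hζ
    have h : ∃ ζ' ∈ Ω, f ((ζ' : E) : A) = f (ζ : A) := ⟨ζ, hζ, rfl⟩
    simp only [F, dif_pos h]
    exact hconst ζ hζ _ h.choose_spec.1 h.choose_spec.2
  refine ⟨F, differentiableOn_of_continuousOn_of_cauchyRiemann ?_ (isOpen_imageD f hf hΩ) ?_, hF⟩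
  · rintro _ ⟨ζ, hζ, rfl⟩
    refine ContinuousAt.continuousWithinAt ?_
    have hcont : Continuous fun ζ : E => f (ζ : A) :=
      (continuous_algHom f).comp continuous_subtype_val
    -- Neighbourhoods of `f ζ` are images of neighbourhoods of `ζ`, so the limit can be computed
    -- upstairs.
    have hmap := (isOpenMap_algHom_restrict f hf).map_nhds_eq hcont.continuousAt (x := ζ)
    change Tendsto F (𝓝 (f (ζ : A))) (𝓝 (F (f (ζ : A))))
    rw [← hmap, tendsto_map'_iff, hF ζ hζ]
    have h1 : Tendsto (fun ζ => l (Φ ζ)) (𝓝 ζ) (𝓝 (l (Φ ζ))) :=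
      (hlc.tendsto _).comp (hΦ.1.continuousAt (hΩ.mem_nhds hζ))
    refine h1.congr' ?_
    filter_upwards [hΩ.mem_nhds hζ] with ξ hξ
    exact (hF ξ hξ).symm
  · rintro _ ⟨ζ, hζ, rfl⟩
    obtain ⟨g, hg⟩ := hΦ.exists_functional_deriv hE hΩ hJ hl hζ
    have key : ∀ w : ℂ, Tendsto (fun ε : ℝ => ε⁻¹ • (F (f (ζ : A) + ε * w) - F (f (ζ : A))))
        (𝓝[>] (0 : ℝ)) (𝓝 (w * g)) := by
      intro w
      obtain ⟨h, hh⟩ := Set.range_eq_univ.1 hf w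
      have h1 := hg h
      simp only at hh
      rw [hh] at h1
      refine h1.congr' ?_
      filter_upwards [tendsto_line ζ h (hΩ.mem_nhds hζ)] with ε hε
      rw [← hF _ hε, ← hF _ hζ]
      congr 3
      rw [Submodule.coe_add, Submodule.coe_smul, map_add, ← hh, ← Complex.coe_smul, map_smul,
        smul_eq_mul]
    have key2 : ∀ w : ℂ, HasDerivAt (fun t : ℝ => F (f (ζ : A) + t * w)) (w * g) 0 := by
      intro w
      refine hasDerivAt_of_right_slopes ?_ ?_
      · simpa using key w
      · simpa using key (-w)
    exact ⟨g, by simpa using key2 1, key2 Complex.I⟩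

/-- The Taylor-type extension of holomorphic functions to the algebra is monogenic. -/
theorem monogenicOn_taylor {f : A →ₐ[ℂ] ℂ} {D : Set ℂ} {T : ℕ → ℂ → ℂ}
    (hT : ∀ j, ∀ z ∈ D, HasDerivAt (T j) ((j + 1 : ℕ) * T (j + 1) z) z) {b : A} {N : ℕ}
    (hb : ∀ x : A, f x = 0 → b * x ^ N = 0) :
    MonogenicOn (E := E) (fun ζ => b * ∑ j ∈ Finset.range (N + 1),
      algebraMap ℂ A (T j (f (ζ : A))) * ((ζ : A) - algebraMap ℂ A (f (ζ : A))) ^ j)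
      {ζ | f (ζ : A) ∈ D} := by
  have := continuousSMul_real (A := A)
  have := isTopologicalRing (A := A)
  have hcf : Continuous fun ζ : E => f (ζ : A) :=
    (continuous_algHom f).comp continuous_subtype_val
  have hcalg := continuous_algebraMap ℂ A
  constructor
  · refine continuousOn_const.mul (continuousOn_finsetSum _ fun j _ => ContinuousOn.mul ?_ ?_)
    · refine hcalg.comp_continuousOn (ContinuousOn.comp (t := D) ?_ hcf.continuousOn
        fun ζ hζ => hζ)
      exact fun z hz => (hT j z hz).continuousAt.continuousWithinAt
    · exact ((continuous_subtype_val.sub (hcalg.comp hcf)).pow j).continuousOn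
  · intro ζ hζ
    set z := f (ζ : A) with hz
    set n : A := (ζ : A) - algebraMap ℂ A z with hn
    refine ⟨b * ∑ j ∈ Finset.range (N + 1),
      algebraMap ℂ A ((j + 1 : ℕ) * T (j + 1) z) * n ^ j, fun h => ?_⟩
    set w := f (h : A) with hw
    set ν : A := (h : A) - algebraMap ℂ A w with hν
    have hfl : ∀ ε : ℝ, f ((ζ + ε • h : E) : A) = z + ε * w := by
      intro ε
      rw [Submodule.coe_add, Submodule.coe_smul, map_add, ← Complex.coe_smul, map_smul,
        smul_eq_mul]
    have h1 : ∀ j, HasRightDeriv (fun ε : ℝ => algebraMap ℂ A (T j (f ((ζ + ε • h : E) : A))))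
        (algebraMap ℂ A ((j + 1 : ℕ) * T (j + 1) z * w)) := by
      intro j
      refine HasRightDeriv.algebraMap ?_
      simp only [hfl]
      have hlin : HasDerivAt (fun t : ℝ => z + (t : ℂ) * w) w 0 := by
        simpa using ((hasDerivAt_id (0 : ℝ)).ofReal_comp.mul_const w).const_add z
      refine HasDerivAt.comp (h₂ := T j) (0 : ℝ) ?_ hlin
      simpa using hT j z hζ
    have h2 : HasRightDeriv (fun ε : ℝ => ((ζ + ε • h : E) : A) -
        algebraMap ℂ A (f ((ζ + ε • h : E) : A))) ν := by
      refine (HasRightDeriv.affine n ν).congr fun ε => ?_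
      have : ∀ ε : ℝ, n + ε • ν = ((ζ + ε • h : E) : A) -
          algebraMap ℂ A (f ((ζ + ε • h : E) : A)) := by
        intro ε
        rw [hfl, map_add, map_mul, ← Algebra.smul_def, hn, hν, smul_sub, Complex.coe_smul,
          Submodule.coe_add, Submodule.coe_smul]
        ring
      simp only [this]
    have h3 := (HasRightDeriv.const b).mul (HasRightDeriv.sum (Finset.range (N + 1))
      fun j _ => (h1 j).mul (h2.pow j))
    have h4 := h3
    unfold HasRightDeriv at h4
    simp only [zero_smul, add_zero] at h4
    convert h4 using 2
    rw [zero_mul, zero_add, mul_left_comm]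
    simp only [← hz, ← hn]
    have hbn : b * n ^ N = 0 := hb n (by simp [hn, ← hz])
    -- With `h = w + ν`, the product rule puts the sum of the `a (j + 1)` in front of `w` and the
    -- sum of the `a j` in front of `ν`. These differ by `a 0 = 0` and by `a (N + 1)`, which
    -- contains `n ^ N` and is killed by `b`. Hence `h` factors out.
    let a : ℕ → A := fun j => algebraMap ℂ A (T j z) * (j * n ^ (j - 1))
    have hsum : b * ∑ j ∈ Finset.range (N + 1), a j = b * ∑ j ∈ Finset.range (N + 1), a (j + 1) := by
      have e := (Finset.sum_range_succ a (N + 1)).symm.trans (Finset.sum_range_succ' a (N + 1))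
      have e0 : a 0 = 0 := by simp [a]
      have e1 : b * a (N + 1) = 0 := by
        simp only [a, Nat.add_sub_cancel]
        linear_combination (algebraMap ℂ A (T (N + 1) z) * ((N + 1 : ℕ) : A)) * hbn
      rw [e0, add_zero] at e
      rw [← e, mul_add, e1, add_zero]
    have hh : (h : A) = algebraMap ℂ A w + ν := by rw [hν]; ring
    have hterm : ∀ j, algebraMap ℂ A ((j + 1 : ℕ) * T (j + 1) z) * n ^ j = a (j + 1) := by
      intro j
      simp only [a, Nat.add_sub_cancel, map_mul, map_natCast]; ring
    have hR : ∀ j, algebraMap ℂ A ((j + 1 : ℕ) * T (j + 1) z * w) * n ^ j +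
        algebraMap ℂ A (T j z) * (j * n ^ (j - 1) * ν) =
        a (j + 1) * algebraMap ℂ A w + a j * ν := by
      intro j
      rw [← hterm, map_mul _ _ w]; simp only [a]; ring
    simp only [hterm, hR, Finset.sum_add_distrib, ← Finset.sum_mul]
    rw [hh]
    linear_combination -ν * hsum

/-- Well-founded induction on an ideal containing the values: subtracting a monogenic lift of `l ∘
Φ`, defined on `Π`, leaves values in a strictly smaller ideal. -/
theorem MonogenicOn.exists_extension (hE : (1 : A) ∈ E) (hΩ : IsOpen Ω)
    (hconv : ∀ f : A →ₐ[ℂ] ℂ, ConvexWrt Ω (directions E f))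
    (hf : ∀ f : A →ₐ[ℂ] ℂ, Set.range (fun ζ : E => f (ζ : A)) = Set.univ) (J : Ideal A)
    (hΦ : MonogenicOn Φ Ω) (hJ : ∀ ζ ∈ Ω, Φ ζ ∈ J) :
    ∃ Ψ : E → A, MonogenicOn Ψ (bigPi Ω) ∧ Set.EqOn Ψ Φ Ω := by
  have : IsArtinianRing A := IsArtinianRing.of_finite ℂ A
  induction J using WellFoundedLT.induction generalizing Φ with
  | ind J ih =>
  by_cases hbot : J = ⊥
  · refine ⟨fun _ => 0, ⟨continuousOn_const, fun ζ _ => ⟨0, fun h => by simp⟩⟩, fun ζ hζ => ?_⟩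
    have := hJ ζ hζ
    rw [hbot, Ideal.mem_bot] at this
    exact this.symm
  obtain ⟨f, l, hl, b, hbJ, hlb⟩ := exists_functional_of_ideal_ne_bot hbot
  obtain ⟨c, N, hfc, hcN⟩ := exists_eq_one_and_mul_pow_eq_zero f
  obtain ⟨F, hFd, hF⟩ := hΦ.exists_holomorphic hE hΩ hJ hl (hconv f) (hf f)
  have hFa := hFd.analyticOnNhd (isOpen_imageD f (hf f) hΩ)
  let T : ℕ → ℂ → ℂ := fun j z => deriv^[j] F z / (j.factorial : ℂ)
  have hT : ∀ j, ∀ z ∈ imageD f Ω, HasDerivAt (T j) ((j + 1 : ℕ) * T (j + 1) z) z := by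
    intro j z hz
    have h1 := ((hFa.iterated_deriv j z hz).differentiableAt.hasDerivAt).div_const
      (j.factorial : ℂ)
    have e : ((j + 1 : ℕ) : ℂ) * T (j + 1) z = deriv (deriv^[j] F) z / (j.factorial : ℂ) := by
      have h2 : ((j + 1 : ℕ) : ℂ) ≠ 0 := Nat.cast_ne_zero.2 j.succ_ne_zero
      have h3 : (j.factorial : ℂ) ≠ 0 := Nat.cast_ne_zero.2 j.factorial_ne_zero
      simp only [T, Function.iterate_succ', Function.comp, Nat.factorial_succ, Nat.cast_mul]
      field_simp
    rw [e]
    exact h1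
  -- The factor `b` keeps the lift in `J` and normalises `l`; the factor `c` kills the `N`-th powers
  -- of elements of `ker f`, without affecting `l` because `f c = 1`.
  have hmono := monogenicOn_taylor (E := E) (b := b * c) hT (N := N) fun x hx => by
    rw [mul_assoc, hcN x hx, mul_zero]
  set Ψ : E → A := fun ζ => b * c * ∑ j ∈ Finset.range (N + 1),
      algebraMap ℂ A (T j (f (ζ : A))) * ((ζ : A) - algebraMap ℂ A (f (ζ : A))) ^ j with hΨ
  have hsub : bigPi Ω ⊆ {ζ : E | f (ζ : A) ∈ imageD f Ω} := fun ζ hζ => hζ f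
  have hΨmono := hmono.mono hsub
  -- Equivariance of `l` makes `J ∩ ker l` an ideal, and `b` witnesses that it is proper in `J`.
  let J' : Ideal A :=
    { carrier := {x | x ∈ J ∧ l x = 0}
      add_mem' := fun hx hy => ⟨J.add_mem hx.1 hy.1, by rw [map_add, hx.2, hy.2, add_zero]⟩
      zero_mem' := ⟨J.zero_mem, map_zero l⟩
      smul_mem' := fun a x hx => ⟨J.mul_mem_left a hx.1, by
        rw [smul_eq_mul, hl a x hx.1, hx.2, mul_zero]⟩ }
  have hJ' : J' < J := by
    refine lt_of_le_of_ne (fun x hx => hx.1) fun h => ?_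
    have hb : b ∈ J' := h ▸ hbJ
    exact one_ne_zero (hlb.symm.trans hb.2)
  obtain ⟨Ψ', hΨ', hEq⟩ := ih J' hJ' (hΦ.sub (hΨmono.mono subset_bigPi)) fun ζ hζ => by
    refine ⟨J.sub_mem (hJ ζ hζ) ?_, ?_⟩
    · rw [hΨ]
      exact J.mul_mem_right _ (J.mul_mem_right _ hbJ)
    -- Since `f` kills `ζ - f ζ`, only the term `j = 0` survives, and it equals `F (f ζ)`.
    · have e : l (Ψ ζ) = l (Φ ζ) := by
        rw [← hF ζ hζ]
        simp only [hΨ]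
        rw [mul_assoc, mul_comm, hl _ _ hbJ, hlb, mul_one, map_mul, hfc, one_mul, map_sum,
          Finset.sum_eq_single 0]
        · simp [T]
        · intro j _ hj
          simp [hj]
        · simp
      rw [map_sub, e, sub_self]
  refine ⟨fun ζ => Ψ' ζ + Ψ ζ, hΨ'.add hΨmono, fun ζ hζ => ?_⟩
  simp only [hEq hζ, sub_add_cancel]

end Monogenic
end MonogenicAlgebra

theorem theorem2 {A : Type*} [CommRing A] [Algebra ℂ A] [FiniteDimensional ℂ A]
    [TopologicalSpace A] [IsTopologicalAddGroup A] [ContinuousSMul ℂ A] [T2Space A]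
    {k : ℕ} (hk : 2 ≤ k) (e : Fin k → A) (he1 : e ⟨0, by omega⟩ = 1)
    (he : LinearIndependent ℝ e)
    (Ω : Set (MonogenicAlgebra.Ek e)) (hΩo : IsOpen Ω) (hΩc : IsConnected Ω)
    (hconv : ∀ f : A →ₐ[ℂ] ℂ,
      MonogenicAlgebra.ConvexWrt Ω (MonogenicAlgebra.directions (MonogenicAlgebra.Ek e) f))
    (hsurj : ∀ f : A →ₐ[ℂ] ℂ,
      Set.range (fun ζ : MonogenicAlgebra.Ek e => f (ζ : A)) = Set.univ) :
    Ω ⊆ MonogenicAlgebra.bigPi Ω ∧ IsOpen (MonogenicAlgebra.bigPi Ω) ∧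
      ∀ Φ : MonogenicAlgebra.Ek e → A, MonogenicAlgebra.MonogenicOn Φ Ω →
        ∃ Ψ : MonogenicAlgebra.Ek e → A,
          MonogenicAlgebra.MonogenicOn Ψ (MonogenicAlgebra.bigPi Ω) ∧ Set.EqOn Ψ Φ Ω := by
  have hE : (1 : A) ∈ MonogenicAlgebra.Ek e := he1 ▸ Submodule.subset_span ⟨_, rfl⟩
  exact ⟨MonogenicAlgebra.subset_bigPi, MonogenicAlgebra.isOpen_bigPi hsurj hΩo, fun Φ hΦ =>
    hΦ.exists_extension hE hΩo hconv hsurj ⊤ fun _ _ => Submodule.mem_top⟩
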